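/- Let $K$ be a finite simplicial complex with totally ordered vertices, $\mathbb F$ a field, and $f:K\to\mathbb R$ a function with $f(\sigma)\le f(\tau)$ whenever $\sigma$ is a face of $\tau$. Order the simplices of $K$ by non-decreasing value of $f$, breaking ties so that faces precede their cofaces, and let $<$ be this filtration order. Let $D_p$ be the matrix of the boundary map over $\mathbb F$, with rows indexed by the $(p-1)$-simplices and columns indexed by the $p$-simplices, both in filtration order. (For $p=0$ it has no rows.) For a column $c$, let $\operatorname{low} c$ be the row of its lowest non-zero entry, i.e. the last row in the order in which $c$ is non-zero; it is undefined if $c=0$. *Pairing.* For given orders of the simplices of each dimension, write $R_p=D_pV_p$ with $V_p$ invertible and upper triangular and with $R_p$ reduced, i.e. the lows of its non-zero columns are distinct. A $(p-1)$-simplex $\sigma$ and a $p$-simplex $\tau$ are *paired* if $\operatorname{low}R_p[\cdot,\tau]=\sigma$. A $p$-simplex $\tau$ is *negative* if $R_p[\cdot,\tau]\neq0$. It is *positive and unpaired* (paired with $\infty$) if $R_p[\cdot,\tau]=0$ and it is not paired with any $(p+1)$-simplex. *Lazy reduction.* Start with $R_p=D_p$, $V_p=I$. For each $p$-simplex $\tau_j$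 in filtration order: while $R_p[\cdot,\tau_j]\ne0$ and there is $\tau_i<\tau_j$ with $\operatorname{low}R_p[\cdot,\tau_i]=\operatorname{low}R_p[\cdot,\tau_j]=:\sigma$, put $\alpha=R_p[\sigma,\tau_j]/R_p[\sigma,\tau_i]$ and subtract $\alpha$ times column $\tau_i$ from column $\tau_j$, both in $R_p$ and in $V_p$. *Accumulated set.* Let $\tau$ be a $p$-simplex with value $d=f(\tau)$, let $d'\le d$, and let $\sigma$ be the partner of $\tau$ (a $(p-1)$-simplex, or $\infty$). Start with $X=\{\tau\}$. Run, from the last one to the first one, through the $p$-simplices $\tau_k$ that precede $\tau$ in the filtration order and satisfy $d'\le f(\tau_k)\le d$. At each step $\tau_k$ immediately precedes the contiguous block $X$ in the current order of the $p$-simplices. Transpose $\tau_k$ past all of $X$; the orders of the simplices of the other dimensions do not change. If this makes $\tau_k$ become paired with $\sigma$ (it was not before the transposition and it is after it), put $\tau_k$ back in front of $X$ and add it to $X$. Otherwise leave $\tau_k$ behind $X$ and leave $X$ unchanged. The final set $X$ is the set accumulated when the value of $\tau$ is decreased from $d$ to $d'$. **Theorem.** Let $R_p=D_pV_p$ be obtained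 by the lazy reduction, let $\tau$ be a $p$-simplex and let $d'\le d=f(\tau)$. 1. If $\tau$ is negative, paired with the $(p-1)$-simplex $\sigma$, then the set accumulated when the value of $\tau$ is decreased from $d$ to $d'$ is $$X_\sigma=\{\tau_i \text{ a } p\text{-simplex} : d'\le f(\tau_i)\le d,\ V_p[\tau_i,\tau]\neq0\}.$$ 2. If $\tau$ is positive and unpaired, the same equality holds for the set accumulated with $\sigma=\infty$. -/

import Mathlib

noncomputable section

namespace LazyPersistence

/-! ### Simplices, filtration orders and boundary matrices -/

/-- The simplices of `K` with exactly `n` vertices, i.e. its `(n - 1)`-simplices. For `n = p + 1`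
these are the `p`-simplices and for `n = p` the `(p - 1)`-simplices (faces are non-empty, so there
are none for `n = 0`). -/
abbrev Simp {W : Type*} (K : PreAbstractSimplicialComplex W) (n : ℕ) : Type _ :=
  {s : K // s.1.card = n}

/-- `L` lists every simplex of `K` exactly once, by non-decreasing value of `f`, faces before
their cofaces. -/
structure IsFiltrationOrder {W : Type*} (K : PreAbstractSimplicialComplex W) (f : K → ℝ)
    (L : List K) : Prop where
  nodup : L.Nodup
  complete : ∀ s : K, s ∈ L
  sorted : L.Pairwise fun s t => f s ≤ f t ∧ ¬ t.1 ⊆ s.1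

/-- The simplices with `n` vertices, in the order in which they appear in `L`. -/
def simplicesOf {W : Type*} {K : PreAbstractSimplicialComplex W} (L : List K) (n : ℕ) :
    List (Simp K n) :=
  L.filterMap fun s => if h : s.1.card = n then some ⟨s, h⟩ else none

/-- The boundary matrix `D_p`: rows are indexed by the `(p - 1)`-simplices, columns by the
`p`-simplices, and the entry at `(σ, τ)` is `(-1) ^ i` if `σ` is obtained from `τ` by deleting its
`i`-th vertex (counted from `0` in the order of the vertices), and `0` if `σ` is not a face. -/
def bdry {W : Type*} [LinearOrder W] (F : Type*) [Field F] (K : PreAbstractSimplicialComplex W)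
    (p : ℕ) : Matrix (Simp K p) (Simp K (p + 1)) F :=
  fun σ τ => ∑ v ∈ τ.1.1,
    if σ.1.1 = τ.1.1.erase v then (-1 : F) ^ (τ.1.1.filter (· < v)).card else 0

/-! ### The lazy reduction -/

section Reduction

variable {m n F : Type*} [Field F]

open Classical in
/-- The row of the lowest non-zero entry of a column `c` when the rows are ordered as in the list
`rows`; `none` for a zero column. -/
def low (rows : List m) (c : m → F) : Option m :=
  rows.reverse.find? fun s => decide (c s ≠ 0)

open Classical in
/-- One more than the position of the lowest non-zero entry (`0` for a zero column). It is only
used to see that the loop below terminates. -/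
def height (rows : List m) (c : m → F) : ℕ :=
  (rows.reverse.dropWhile fun s => decide (c s = 0)).length

open Classical in
theorem height_sub_lt (rows : List m) (c e : m → F) (σ : m)
    (hc : low rows c = some σ) (he : low rows e = some σ) :
    height rows (c - (c σ / e σ) • e) < height rows c := by
  unfold low at hc he
  unfold height
  generalize rows.reverse = l at hc he ⊢
  induction l with
  | nil => simp at hc
  | cons a l ih =>
    by_cases hca : c a = 0
    · have hea : e a = 0 := by
        by_contra hea
        have h1 : a = σ := by simpa [List.find?_cons, hea] using he
        rw [← h1] at hc
        have := List.find?_some hc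
        simp [hca] at this
      simpa [List.dropWhile_cons, hca, hea] using
        ih (by simpa [List.find?_cons, hca] using hc) (by simpa [List.find?_cons, hea] using he)
    · have h1 : a = σ := by simpa [List.find?_cons, hca] using hc
      have heσ : e σ ≠ 0 := by simpa using List.find?_some he
      subst h1
      have h2 : (c - (c a / e a) • e) a = 0 := by simp [heσ]
      rw [List.dropWhile_cons, List.dropWhile_cons, if_pos (by simp [h2]), if_neg (by simp [hca])]
      exact Nat.lt_succ_of_le (List.length_dropWhile_le _ _)

open Classical in
/-- The inner `while` loop: as long as the column of `j` in `R` is non-zero and some column `i`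
among the `earlier` ones has the same lowest row `σ`, subtract `α = R[σ, j] / R[σ, i]` times column
`i` from column `j`, both in `R` and in `V`. -/
def reduceColumn (rows : List m) (earlier : List n) (j : n) (R : Matrix m n F)
    (V : Matrix n n F) : Matrix m n F × Matrix n n F :=
  match hσ : low rows (R.col j) with
  | none => (R, V)
  | some σ =>
    match hi : earlier.find? (fun i => decide (low rows (R.col i) = some σ)) with
    | none => (R, V)
    | some i =>
      reduceColumn rows earlier j
        (R.updateCol j (R.col j - (R σ j / R σ i) • R.col i))
        (V.updateCol j (V.col j - (R σ j / R σ i) • V.col i))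
termination_by height rows (R.col j)
decreasing_by
  have h1 : low rows (R.col i) = some σ := by simpa using List.find?_some hi
  have h2 : (R.updateCol j (R.col j - (R σ j / R σ i) • R.col i)).col j =
      R.col j - (R.col j σ / R.col i σ) • R.col i := by
    ext s; simp [Matrix.col_apply]
  rw [h2]
  exact height_sub_lt rows _ _ σ hσ h1

/-- The outer loop, over the columns in order; `earlier` are those already treated. -/
def reduceColumns (rows : List m) :
    List n → List n → Matrix m n F × Matrix n n F → Matrix m n F × Matrix n n F
  | _, [], S => S
  | earlier, j :: js, S =>
    reduceColumns rows (earlier ++ [j]) js (reduceColumn rows earlier j S.1 S.2)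

/-- The lazy reduction of `D` for the given orders of its rows and columns: the pair `(R, V)`,
started at `(D, 1)`. -/
def lazyReduction [DecidableEq n] (rows : List m) (cols : List n) (D : Matrix m n F) :
    Matrix m n F × Matrix n n F :=
  reduceColumns rows [] cols (D, 1)

/-! ### The persistence pairing -/

/-- `R = D V` with `R` reduced (the lowest non-zero entries of its non-zero columns are in distinct
rows) and `V` invertible and upper triangular, for the given orders of rows and columns. -/
structure IsReduction [Fintype n] [DecidableEq n] (rows : List m) (cols : List n)
    (D R : Matrix m n F) (V : Matrix n n F) : Prop where
  eq_mul : R = D * V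
  invertible : IsUnit V
  upper : ∀ i j, V i j ≠ 0 → cols.idxOf i ≤ cols.idxOf j
  reduced : ∀ i j σ, low rows (R.col i) = some σ → low rows (R.col j) = some σ → i = j

/-- `σ` and `τ` are paired: the lowest non-zero entry in the column of `τ` in a reduced matrix
`R = D V` is in row `σ`. -/
def IsPaired [Fintype n] [DecidableEq n] (rows : List m) (cols : List n) (D : Matrix m n F)
    (σ : m) (τ : n) : Prop :=
  ∃ R V, IsReduction rows cols D R V ∧ low rows (R.col τ) = some σ

/-- `τ` is positive and unpaired: its column in a reduced matrix `R = D V` is zero, and it is not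
paired with any column of the next boundary matrix `D'`, whose rows are the columns of `D`. -/
def IsUnpaired {l : Type*} [Fintype n] [DecidableEq n] [Fintype l] [DecidableEq l]
    (rows : List m) (cols : List n) (next : List l) (D : Matrix m n F) (D' : Matrix n l F)
    (τ : n) : Prop :=
  (∃ R V, IsReduction rows cols D R V ∧ low rows (R.col τ) = none) ∧
    ∀ ρ : l, ¬ IsPaired cols next D' τ ρ

end Reduction

/-! ### Moving a simplex down by transpositions -/

section Transpositions

variable {n : Type*}

open Classical in
/-- The loop that moves the set `X` down past the simplices `todo` (nearest first). The current
order is `pre ++ todo.reverse ++ X ++ post`, and `Q o t` says that `t` has the pairing in question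
when the order is `o`. The next simplex `t` is transposed past `X`. If this makes its pairing become
the one in question, `t` is put back in front of `X` and joins `X`; otherwise it stays behind `X`.
The result is the accumulated set `X`. -/
def accumulate (Q : List n → n → Prop) (pre : List n) : List n → List n → List n → List n
  | [], X, _ => X
  | t :: todo, X, post =>
    if ¬ Q (pre ++ todo.reverse ++ [t] ++ X ++ post) t ∧
        Q (pre ++ todo.reverse ++ X ++ [t] ++ post) t then
      accumulate Q pre todo (t :: X) post
    else
      accumulate Q pre todo X (t :: post)

open Classical in
/-- The set accumulated when the value of `τ` is decreased to `d'`: the loop starts with `X = {τ}`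
and runs through the simplices before `τ` in `order` whose value `g` is at least `d'`, from the last
one to the first one. -/
def accumulatedSet (Q : List n → n → Prop) (order : List n) (g : n → ℝ) (d' : ℝ) (τ : n) :
    Set n :=
  let before := order.takeWhile fun t => decide (t ≠ τ)
  let after := (order.dropWhile fun t => decide (t ≠ τ)).tail
  {t | t ∈ accumulate Q (before.filter fun t => decide (g t < d'))
    (before.filter fun t => decide (d' ≤ g t)).reverse [τ] after}

end Transpositions

end LazyPersistence

end

/-!
Two facts carry the proof.

*The pairing as a statement about linear combinations.* Let `t` stand in some order of the columns
with the set `A` before it. Then `t` is paired with `σ` if and only if `σ` is the low of a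
combination of columns in `A ∪ {t}` but not of one of columns in `A` (`isPaired_append_iff`), and
`t` is positive and unpaired if and only if some cycle supported on `A ∪ {t}`, but no such boundary,
is non-zero at `t` (`isUnpaired_append_iff`). Here one uses that the columns of `V` form a
triangular basis, and that in a combination of columns of a reduced matrix nothing cancels in the
lowest of the lows involved (`exists_isTop_mulVec`).

*The lazy reduction uses only low columns.* If `V i τ ≠ 0` with `i ≠ τ`, then the reduced column of
`i` is non-zero and its low is strictly below every non-zero entry of the reduced column of `τ`
(`IsLazy`, `isLazy_lazyReduction`): each subtraction moves the low of the column strictly up, and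
the columns used earlier for column `i` have even lower lows. Consequently, if the last position of
a vector `u` is such a column, then `D u` has a non-zero entry below all those of the column of `τ`
(`IsLazy.exists_mulVec_ne_zero`).

Suppose now that `t` is about to be transposed past the block `X`, where `A` is the set before `t`
and `X` consists of the simplices after `t` in the support of the column `v` of `τ` in `V`. If
`V t τ = 0`, then `v` lives on `A ∪ X`. For `τ` paired with `σ`, it shows that `σ` is already a low
without `t`, so `t` does not become paired with `σ`. If `V t τ ≠ 0`, then `v` shows that `σ` becomes
a low once `t` is added to `A ∪ X`. Were `σ` the low of `D w` with `w` on `A ∪ X`, then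
`v - w / w τ` would vanish at `τ` but not at `t`, so its last position would be `t` or in `X`, hence
a column used to reduce `τ`; but its image under `D` has no entry below `σ`
(`isPaired_transposition_iff`). For `τ` positive and unpaired, `v` is a cycle, and the same argument
applied to cycles and boundaries, which are cycles by `bdry_mul_bdry`, shows that `t` becomes
unpaired exactly if `V t τ ≠ 0` (`isUnpaired_transposition_iff`). By induction the accumulated set
is the support of `v` in the given range of values (`accumulate_eq`, `IsLazy.accumulatedSet_eq`).
-/

namespace LazyPersistence

open Matrix

/-! ### Lowest non-zero entries -/

section Top

variable {ι F : Type*} [Field F]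

/-- `s` is the last index, in the order given by the rank function `r`, at which the vector `c` is
non-zero. -/
def IsTop (r : ι → ℕ) (c : ι → F) (s : ι) : Prop :=
  c s ≠ 0 ∧ ∀ t, c t ≠ 0 → r t ≤ r s

theorem IsTop.unique {r : ι → ℕ} (hr : r.Injective) {c : ι → F} {s s' : ι} (h : IsTop r c s)
    (h' : IsTop r c s') : s = s' :=
  hr (le_antisymm (h'.2 s h.1) (h.2 s' h'.1))

theorem exists_isTop [Finite ι] (r : ι → ℕ) {c : ι → F} (h : ∃ t, c t ≠ 0) :
    ∃ s, IsTop r c s := by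
  obtain ⟨s, hs, hmax⟩ := Set.exists_max_image {t | c t ≠ 0} r (Set.toFinite _) h
  exact ⟨s, hs, hmax⟩

end Top

section Order

variable {ι F : Type*} [Field F]

/-- The list `l` is a total order of all of `ι`. -/
structure IsOrder (l : List ι) : Prop where
  nodup : l.Nodup
  complete : ∀ i, i ∈ l

theorem IsOrder.perm {l l' : List ι} (h : IsOrder l) (hp : l'.Perm l) : IsOrder l' :=
  ⟨hp.nodup_iff.2 h.nodup, fun i => hp.mem_iff.2 (h.complete i)⟩

theorem low_eq_none_iff {rows : List ι} (h : IsOrder rows) (c : ι → F) :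
    low rows c = none ↔ ∀ s, c s = 0 := by
  simp [low, h.complete]

variable [DecidableEq ι]

theorem IsOrder.injective {l : List ι} (h : IsOrder l) : Function.Injective (l.idxOf ·) :=
  fun i _ hij => (List.idxOf_inj (h.complete i)).1 hij

theorem idxOf_le_iff {A B : List ι} {t i : ι} (h : IsOrder (A ++ t :: B)) :
    (A ++ t :: B).idxOf i ≤ (A ++ t :: B).idxOf t ↔ i ∈ A ∨ i = t := by
  have ht : t ∉ A := fun hA => by
    have := h.nodup
    simp [List.nodup_append] at this
    exact (this.2.2 t hA).1 rfl
  by_cases hi : i ∈ A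
  · have := List.idxOf_lt_length_of_mem hi
    simp only [List.idxOf_append, hi, ht, if_true, if_false, List.idxOf_cons_self, true_or,
      iff_true]
    omega
  · by_cases hit : i = t
    · simp [hit]
    · have h1 : (t == i) = false := by simpa using fun h => hit h.symm
      simp [List.idxOf_append, hi, ht, hit, List.idxOf_cons, h1]

theorem idxOf_lt_iff {A B : List ι} {t i : ι} (h : IsOrder (A ++ t :: B)) :
    (A ++ t :: B).idxOf i < (A ++ t :: B).idxOf t ↔ i ∈ A := by
  have ht : t ∉ A := fun hA => by
    have := h.nodup
    simp [List.nodup_append] at this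
    exact (this.2.2 t hA).1 rfl
  rw [lt_iff_le_and_ne, idxOf_le_iff h]
  constructor
  · rintro ⟨h1 | rfl, h2⟩
    · exact h1
    · exact absurd rfl h2
  · intro hi
    refine ⟨Or.inl hi, fun he => ht ?_⟩
    rwa [← h.injective he]

theorem isTop_append_iff {A B : List ι} {t : ι} (h : IsOrder (A ++ t :: B)) (u : ι → F) :
    IsTop (A ++ t :: B).idxOf u t ↔ u t ≠ 0 ∧ ∀ i, u i ≠ 0 → i ∈ A ∨ i = t := by
  simp only [IsTop, idxOf_le_iff h]

theorem low_eq_some_iff {rows : List ι} (h : IsOrder rows) (c : ι → F) (s : ι) :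
    low rows c = some s ↔ IsTop rows.idxOf c s := by
  have key : ∀ s, low rows c = some s → IsTop rows.idxOf c s := by
    intro s hs
    obtain ⟨hcs, as, bs, hl, has⟩ := List.find?_eq_some_iff_append.1 hs
    have hrows : rows = bs.reverse ++ s :: as.reverse := by
      rw [← List.reverse_reverse rows, hl]; simp
    subst hrows
    refine (isTop_append_iff h c).2 ⟨by simpa using hcs, fun t ht => ?_⟩
    have := h.complete t
    simp only [List.mem_append, List.mem_cons, List.mem_reverse] at this ⊢
    rcases this with h1 | h1 | h1
    · exact Or.inl h1
    · exact Or.inr h1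
    · exact absurd (has t h1) (by simpa using ht)
  refine ⟨key s, fun hs => ?_⟩
  cases hl : low rows c with
  | none => exact absurd ((low_eq_none_iff h c).1 hl s) hs.1
  | some s' => rw [(key s' hl).unique h.injective hs]

end Order

/-! ### Reduced matrices -/

section Reduced

variable {m n F : Type*} [Field F] [Fintype n]

theorem exists_ne_zero_of_mulVec {M : Matrix m n F} {γ : n → F} {s : m} (h : (M *ᵥ γ) s ≠ 0) :
    ∃ j, M s j ≠ 0 ∧ γ j ≠ 0 := by
  obtain ⟨j, -, hj⟩ := Finset.exists_ne_zero_of_sum_ne_zero h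
  exact ⟨j, left_ne_zero_of_mul hj, right_ne_zero_of_mul hj⟩

/-- Nothing cancels below the lowest of the lows of the columns entering a linear combination of
the columns of a reduced matrix. -/
theorem exists_isTop_mulVec [Finite m] {r : m → ℕ} {R : Matrix m n F}
    (hR : ∀ i j s, IsTop r (R.col i) s → IsTop r (R.col j) s → i = j) {γ : n → F} {k : n} {q : m}
    (hk : γ k ≠ 0) (hq : R q k ≠ 0) :
    ∃ i s, γ i ≠ 0 ∧ IsTop r (R.col i) s ∧ (∀ j s', γ j ≠ 0 → R s' j ≠ 0 → r s' ≤ r s) ∧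
      IsTop r (R *ᵥ γ) s := by
  obtain ⟨⟨i, s⟩, ⟨hi, hs⟩, hmax⟩ := Set.exists_max_image
    {x : n × m | γ x.1 ≠ 0 ∧ R x.2 x.1 ≠ 0} (fun x => r x.2) (Set.toFinite _) ⟨(k, q), hk, hq⟩
  have hmax' : ∀ j s', γ j ≠ 0 → R s' j ≠ 0 → r s' ≤ r s := fun j s' h1 h2 => hmax (j, s') ⟨h1, h2⟩
  have htop : IsTop r (R.col i) s := ⟨hs, fun s' h => hmax' i s' hi h⟩
  refine ⟨i, s, hi, htop, hmax', ?_, fun s' hs' => ?_⟩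
  · have : (R *ᵥ γ) s = R s i * γ i := by
      refine Finset.sum_eq_single i (fun j _ hji => ?_) (by simp)
      by_contra h
      have h1 := left_ne_zero_of_mul h
      have h2 := right_ne_zero_of_mul h
      exact hji (hR j i s ⟨h1, fun s' h => hmax' j s' h2 h⟩ htop)
    rw [this]
    exact mul_ne_zero hs hi
  · obtain ⟨j, h1, h2⟩ := exists_ne_zero_of_mulVec hs'
    exact hmax' j s' h2 h1

/-- An invertible triangular matrix does not change the last non-zero position of a vector. -/
theorem IsTop.mulVec {b : n → ℕ} (hb : b.Injective) {V : Matrix n n F} (hV : V.BlockTriangular b)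
    (hd : ∀ i, V i i ≠ 0) {γ : n → F} {t : n} (h : IsTop b γ t) : IsTop b (V *ᵥ γ) t := by
  have hle : ∀ i j, V i j ≠ 0 → b i ≤ b j := fun i j hij => by
    by_contra hlt
    exact hij (hV (not_le.1 hlt))
  refine ⟨?_, fun i hi => ?_⟩
  · have : (V *ᵥ γ) t = V t t * γ t := by
      refine Finset.sum_eq_single t (fun j _ hjt => ?_) (by simp)
      by_contra hne
      exact hjt (hb (le_antisymm (h.2 j (right_ne_zero_of_mul hne))
        (hle t j (left_ne_zero_of_mul hne))))
    rw [this]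
    exact mul_ne_zero (hd t) h.1
  · obtain ⟨j, h1, h2⟩ := exists_ne_zero_of_mulVec hi
    exact (hle i j h1).trans (h.2 j h2)

theorem diag_ne_zero_of_mul_eq_one [DecidableEq n] {b : n → ℕ} (hb : b.Injective)
    {V U : Matrix n n F} (hV : V.BlockTriangular b) (hU : U.BlockTriangular b) (h : V * U = 1)
    (i : n) : V i i ≠ 0 ∧ U i i ≠ 0 := by
  have h1 : (V * U) i i = V i i * U i i := by
    rw [Matrix.mul_apply]
    refine Finset.sum_eq_single i (fun j _ hji => ?_) (by simp)
    rcases lt_trichotomy (b i) (b j) with hlt | heq | hlt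
    · rw [hU hlt, mul_zero]
    · exact absurd (hb heq).symm hji
    · rw [hV hlt, zero_mul]
  rw [h, Matrix.one_apply_eq] at h1
  exact ⟨left_ne_zero_of_mul (h1 ▸ one_ne_zero), right_ne_zero_of_mul (h1 ▸ one_ne_zero)⟩

variable [DecidableEq n] {rows : List m} {cols : List n} {D R : Matrix m n F} {V : Matrix n n F}

theorem IsReduction.blockTriangular (h : IsReduction rows cols D R V) :
    V.BlockTriangular (cols.idxOf ·) := fun i j hij => by
  by_contra hne
  exact absurd (h.upper i j hne) (not_le.2 hij)

/-- Every vector `u` has coordinates `γ` in the basis formed by the columns of `V`; as `V` is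
triangular, `u` and `γ` have the same last non-zero position. -/
theorem IsReduction.exists_coeff (hc : IsOrder cols) (h : IsReduction rows cols D R V)
    (u : n → F) : ∃ γ, D *ᵥ u = R *ᵥ γ ∧
      ∀ t, IsTop cols.idxOf u t → IsTop cols.idxOf γ t := by
  obtain ⟨hinv⟩ := h.invertible.nonempty_invertible
  have hU := blockTriangular_inv_of_blockTriangular h.blockTriangular
  have hVU : V * V⁻¹ = 1 := Matrix.mul_inv_of_invertible V
  refine ⟨V⁻¹ *ᵥ u, ?_, fun t ht => ?_⟩
  · rw [h.eq_mul, Matrix.mulVec_mulVec, Matrix.mul_assoc, hVU, Matrix.mul_one]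
  · exact ht.mulVec hc.injective hU
      fun i => (diag_ne_zero_of_mul_eq_one hc.injective h.blockTriangular hU hVU i).2

theorem IsReduction.isTop_col (hc : IsOrder cols) (h : IsReduction rows cols D R V) (j : n) :
    IsTop cols.idxOf (V.col j) j := by
  obtain ⟨hinv⟩ := h.invertible.nonempty_invertible
  have hU := blockTriangular_inv_of_blockTriangular h.blockTriangular
  exact ⟨(diag_ne_zero_of_mul_eq_one hc.injective h.blockTriangular hU
    (Matrix.mul_inv_of_invertible V) j).1, fun i hi => h.upper i j hi⟩

theorem IsReduction.mulVec_col (h : IsReduction rows cols D R V) (j : n) :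
    D *ᵥ V.col j = R.col j := by
  rw [h.eq_mul]; rfl

variable [DecidableEq m]

theorem IsReduction.isTop_unique (hr : IsOrder rows) (h : IsReduction rows cols D R V) (i j : n)
    (s : m) (hi : IsTop rows.idxOf (R.col i) s) (hj : IsTop rows.idxOf (R.col j) s) : i = j :=
  h.reduced i j s ((low_eq_some_iff hr _ _).2 hi) ((low_eq_some_iff hr _ _).2 hj)

variable [Finite m]

/-- If `k` is the last position of `u`, then the lowest non-zero entry of `D u` is not above that
of the reduced column of `k`. -/
theorem IsReduction.exists_mulVec_ne_zero (hr : IsOrder rows) (hc : IsOrder cols)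
    (h : IsReduction rows cols D R V) {u : n → F} {k : n} (hk : IsTop cols.idxOf u k) {q : m}
    (hq : R q k ≠ 0) : ∃ s, (D *ᵥ u) s ≠ 0 ∧ rows.idxOf q ≤ rows.idxOf s := by
  obtain ⟨γ, hD, hγ⟩ := h.exists_coeff hc u
  obtain ⟨i, s, -, -, hmax, htop⟩ :=
    exists_isTop_mulVec (r := rows.idxOf) (h.isTop_unique hr) (hγ k hk).1 hq
  exact ⟨s, hD ▸ htop.1, hmax k q (hγ k hk).1 hq⟩

/-- A row that is the low of some `D u` is the low of a reduced column, which does not come after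
the last position of `u`. -/
theorem IsReduction.exists_isTop_col (hr : IsOrder rows) (hc : IsOrder cols)
    (h : IsReduction rows cols D R V) {u : n → F} {σ : m} (hσ : IsTop rows.idxOf (D *ᵥ u) σ) :
    ∃ i, IsTop rows.idxOf (R.col i) σ ∧ ∀ k, IsTop cols.idxOf u k →
      cols.idxOf i ≤ cols.idxOf k := by
  obtain ⟨γ, hD, hγ⟩ := h.exists_coeff hc u
  rw [hD] at hσ
  obtain ⟨j, h1, h2⟩ := exists_ne_zero_of_mulVec hσ.1
  obtain ⟨i, s, hi, hs, -, htop⟩ := exists_isTop_mulVec (r := rows.idxOf) (h.isTop_unique hr) h2 h1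
  obtain rfl := hσ.unique hr.injective htop
  exact ⟨i, hs, fun k hk => (hγ k hk).2 i hi⟩

end Reduced

/-! ### Correctness of the lazy reduction -/

theorem col_updateCol_of_ne {m n F : Type*} [DecidableEq n] (M : Matrix m n F) (c : m → F)
    {i j : n} (h : i ≠ j) :
    (M.updateCol j c).col i = M.col i := by
  ext s; simp [Matrix.col_apply, Matrix.updateCol_ne h]

section Lazy

variable {m n F : Type*} [Field F] [Fintype n] [DecidableEq m] [DecidableEq n]

/-- The invariant of the lazy reduction when the columns in `E` have been treated: a column `i ≠ j`
enters column `j` of `V` only if it has been treated, precedes `j`, and its reduced column has its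
low strictly below the one of the current column `j`. -/
structure IsLazy (rows : List m) (cols : List n) (D : Matrix m n F) (E : List n)
    (R : Matrix m n F) (V : Matrix n n F) : Prop where
  eq_mul : R = D * V
  diag : ∀ j, V j j = 1
  lazy : ∀ i j, V i j ≠ 0 → i ≠ j → i ∈ E ∧ cols.idxOf i < cols.idxOf j ∧
    ∃ s, IsTop rows.idxOf (R.col i) s ∧ ∀ s', R s' j ≠ 0 → rows.idxOf s' < rows.idxOf s
  reduced : ∀ i ∈ E, ∀ j ∈ E, ∀ s,
    IsTop rows.idxOf (R.col i) s → IsTop rows.idxOf (R.col j) s → i = j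

variable {rows : List m} {cols E : List n} {D R : Matrix m n F} {V : Matrix n n F}

theorem isLazy_one : IsLazy rows cols D [] D 1 where
  eq_mul := (Matrix.mul_one D).symm
  diag := Matrix.one_apply_eq
  lazy i j h hij := absurd (Matrix.one_apply_ne hij) h
  reduced := by simp

/-- One subtraction in the inner loop of the lazy reduction preserves the invariant. -/
theorem IsLazy.step (hr : IsOrder rows) (h : IsLazy rows cols D E R V) {i j : n} {s : m}
    (hj : j ∉ E) (hi : i ∈ E) (hij : cols.idxOf i < cols.idxOf j)
    (hsi : IsTop rows.idxOf (R.col i) s) (hsj : IsTop rows.idxOf (R.col j) s) :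
    IsLazy rows cols D E (R.updateCol j (R.col j - (R s j / R s i) • R.col i))
      (V.updateCol j (V.col j - (R s j / R s i) • V.col i)) := by
  have hne : ∀ k ∈ E, k ≠ j := fun k hk hkj => hj (hkj ▸ hk)
  have hsi0 : R s i ≠ 0 := hsi.1
  -- the new column of `j` lives strictly above row `s`
  have hnew : ∀ s', R s' j - (R s j / R s i) * R s' i ≠ 0 → rows.idxOf s' < rows.idxOf s := by
    intro s' hs'
    refine lt_of_le_of_ne ?_ fun he => ?_
    · by_cases h1 : R s' j = 0
      · refine hsi.2 s' fun h2 => hs' ?_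
        have h2 : R s' i = 0 := h2
        rw [h1, h2]; simp
      · exact hsj.2 s' h1
    · obtain rfl := hr.injective he
      exact hs' (by field_simp; simp)
  refine ⟨?_, fun k => ?_, fun a k hak hne' => ?_, fun a ha b hb q hqa hqb => ?_⟩
  · ext q k
    by_cases hk : k = j
    · subst hk
      simp [h.eq_mul, Matrix.mul_apply, Matrix.col_apply, mul_sub, Finset.mul_sum, mul_left_comm]
    · simp [h.eq_mul, Matrix.mul_apply, hk]
  · by_cases hk : k = j
    · subst hk
      have : V k i = 0 := by
        by_contra h0
        exact hj (h.lazy k i h0 (hne i hi).symm).1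
      simp [Matrix.col_apply, h.diag, this]
    · simp [hk, h.diag]
  · by_cases hk : k = j
    · subst hk
      have hor : V a k ≠ 0 ∨ V a i ≠ 0 := by
        by_contra! h0
        exact hak (by simp [Matrix.col_apply, h0.1, h0.2])
      have hgoal : a ∈ E ∧ cols.idxOf a < cols.idxOf k ∧ ∃ q, IsTop rows.idxOf (R.col a) q ∧
          rows.idxOf s ≤ rows.idxOf q := by
        rcases hor with h0 | h0
        · obtain ⟨h1, h2, q, h3, h4⟩ := h.lazy a k h0 hne'
          exact ⟨h1, h2, q, h3, (h4 s hsj.1).le⟩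
        · by_cases hai : a = i
          · subst hai
            exact ⟨hi, hij, s, hsi, le_rfl⟩
          · obtain ⟨h1, h2, q, h3, h4⟩ := h.lazy a i h0 hai
            exact ⟨h1, h2.trans hij, q, h3, (h4 s hsi.1).le⟩
      obtain ⟨h1, h2, q, h3, h4⟩ := hgoal
      refine ⟨h1, h2, q, ?_, fun s' hs' => (hnew s' ?_).trans_le h4⟩
      · rwa [col_updateCol_of_ne _ _ hne']
      · simpa [Matrix.col_apply] using hs'
    · obtain ⟨h1, h2, q, h3, h4⟩ := h.lazy a k (by simpa [hk] using hak) hne'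
      refine ⟨h1, h2, q, ?_, fun s' hs' => h4 s' (by simpa [hk] using hs')⟩
      rwa [col_updateCol_of_ne _ _ (hne a h1)]
  · rw [col_updateCol_of_ne _ _ (hne a ha)] at hqa
    rw [col_updateCol_of_ne _ _ (hne b hb)] at hqb
    exact h.reduced a ha b hb q hqa hqb

/-- When the low of column `j` is not the low of a treated column, column `j` is finished. -/
theorem IsLazy.append (h : IsLazy rows cols D E R V) {j : n}
    (hj : ∀ i ∈ E, ∀ s, IsTop rows.idxOf (R.col i) s → ¬ IsTop rows.idxOf (R.col j) s) :
    IsLazy rows cols D (E ++ [j]) R V where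
  eq_mul := h.eq_mul
  diag := h.diag
  lazy i k hik hne :=
    have := h.lazy i k hik hne
    ⟨List.mem_append_left _ this.1, this.2⟩
  reduced a ha b hb s hsa hsb := by
    simp only [List.mem_append, List.mem_singleton] at ha hb
    rcases ha with ha | rfl <;> rcases hb with hb | rfl
    · exact h.reduced a ha b hb s hsa hsb
    · exact absurd hsb (hj a ha s hsa)
    · exact absurd hsa (hj b hb s hsb)
    · rfl

theorem IsLazy.reduceColumn (hr : IsOrder rows) {j : n} (hj : j ∉ E)
    (hEj : ∀ i ∈ E, cols.idxOf i < cols.idxOf j) (h : IsLazy rows cols D E R V) :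
    IsLazy rows cols D (E ++ [j]) (reduceColumn rows E j R V).1 (reduceColumn rows E j R V).2 := by
  induction hN : height rows (R.col j) using Nat.strong_induction_on generalizing R V with
  | _ N ih =>
    rw [LazyPersistence.reduceColumn]
    split
    · rename_i hσ
      exact h.append fun i _ s _ hs => hs.1 ((low_eq_none_iff hr _).1 hσ s)
    · rename_i σ hσ
      split
      · rename_i hi
        refine h.append fun i hiE s hs hsj => ?_
        rw [← low_eq_some_iff hr] at hs hsj
        rw [hσ] at hsj
        cases hsj
        simpa [hs] using List.find?_eq_none.1 hi i hiE
      · rename_i i hi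
        have hiE := List.mem_of_find?_eq_some hi
        have hlow : low rows (R.col i) = some σ := by simpa using List.find?_some hi
        refine ih _ ?_ ?_ rfl
        · have hcol (_ : DecidableEq n) :
              (R.updateCol j (R.col j - (R σ j / R σ i) • R.col i)).col j =
                R.col j - (R.col j σ / R.col i σ) • R.col i := by
            ext s; simp [Matrix.col_apply]
          exact (congrArg (height rows) (hcol _)).trans_lt
            ((height_sub_lt rows _ _ σ hσ hlow).trans_eq hN)
        · convert h.step hr hj hiE (hEj i hiE) ((low_eq_some_iff hr _ _).1 hlow)
            ((low_eq_some_iff hr _ _).1 hσ)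

theorem IsLazy.reduceColumns (hr : IsOrder rows) (hc : IsOrder cols) {js : List n}
    (hcols : cols = E ++ js) (h : IsLazy rows cols D E R V) :
    IsLazy rows cols D cols (reduceColumns rows E js (R, V)).1
      (reduceColumns rows E js (R, V)).2 := by
  induction js generalizing E R V with
  | nil =>
    rw [List.append_nil] at hcols
    subst hcols
    exact h
  | cons j js ih =>
    have hlt : ∀ i ∈ E, cols.idxOf i < cols.idxOf j := by
      subst hcols
      exact fun i hi => (idxOf_lt_iff hc).2 hi
    exact ih (by simp [hcols]) (h.reduceColumn hr (fun hj => (hlt j hj).false) hlt)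

theorem isLazy_lazyReduction (hr : IsOrder rows) (hc : IsOrder cols) (D : Matrix m n F) :
    IsLazy rows cols D cols (lazyReduction rows cols D).1 (lazyReduction rows cols D).2 :=
  isLazy_one.reduceColumns hr hc rfl

theorem IsLazy.isReduction (hr : IsOrder rows) (hc : IsOrder cols)
    (h : IsLazy rows cols D cols R V) : IsReduction rows cols D R V where
  eq_mul := h.eq_mul
  invertible := by
    let _ : LinearOrder n := LinearOrder.lift' (cols.idxOf ·) hc.injective
    rw [Matrix.isUnit_iff_isUnit_det]
    have hV : V.IsUpperTriangular := fun i j hij => by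
      by_contra hne
      exact absurd (h.lazy i j hne (ne_of_gt hij)).2.1 (not_lt.2 (le_of_lt hij))
    have := Matrix.det_of_isUpperTriangular hV
    simp only [h.diag, Finset.prod_const_one] at this
    convert isUnit_one
  upper i j hij := by
    by_cases hne : i = j
    · rw [hne]
    · exact (h.lazy i j hij hne).2.1.le
  reduced i j s hi hj := h.reduced i (hc.complete i) j (hc.complete j) s
    ((low_eq_some_iff hr _ _).1 hi) ((low_eq_some_iff hr _ _).1 hj)

theorem exists_isReduction (hr : IsOrder rows) (hc : IsOrder cols) (D : Matrix m n F) :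
    ∃ R V, IsReduction rows cols D R V :=
  ⟨_, _, (isLazy_lazyReduction hr hc D).isReduction hr hc⟩

end Lazy

/-! ### Pairings in terms of linear combinations of columns -/

section Pairing

variable {l m n F : Type*} [Field F] [Fintype n] [Finite m] [DecidableEq m] [DecidableEq n]
  {rows : List m} {A B : List n} {t : n} {D : Matrix m n F}

/-- The pairing of `t` depends only on the set of columns before `t`: `t` is paired with `σ` if `σ`
is the low of a combination of the columns up to `t`, but not of one of the columns before `t`. -/
theorem isPaired_append_iff (hr : IsOrder rows) (hc : IsOrder (A ++ t :: B)) (σ : m) :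
    IsPaired rows (A ++ t :: B) D σ t ↔
      (∃ u : n → F, (∀ i, u i ≠ 0 → i ∈ A ∨ i = t) ∧ IsTop rows.idxOf (D *ᵥ u) σ) ∧
      ∀ u : n → F, (∀ i, u i ≠ 0 → i ∈ A) → ¬ IsTop rows.idxOf (D *ᵥ u) σ := by
  constructor
  · rintro ⟨R, V, h, hlow⟩
    rw [low_eq_some_iff hr] at hlow
    refine ⟨⟨V.col t, ((isTop_append_iff hc _).1 (h.isTop_col hc t)).2, ?_⟩, fun u hu hσ => ?_⟩
    · rwa [h.mulVec_col]
    · obtain ⟨i, hi, hik⟩ := h.exists_isTop_col hr hc hσ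
      obtain rfl := h.isTop_unique hr _ _ _ hlow hi
      obtain ⟨j, -, hj⟩ := exists_ne_zero_of_mulVec hσ.1
      obtain ⟨k, hk⟩ := exists_isTop (A ++ t :: B).idxOf ⟨j, hj⟩
      exact absurd ((idxOf_lt_iff hc).2 (hu k hk.1)) (not_lt.2 (hik k hk))
  · rintro ⟨⟨u, hu, hσ⟩, hno⟩
    obtain ⟨R, V, h⟩ := exists_isReduction hr hc D
    obtain ⟨i, hi, hik⟩ := h.exists_isTop_col hr hc hσ
    obtain ⟨j, -, hj⟩ := exists_ne_zero_of_mulVec hσ.1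
    obtain ⟨k, hk⟩ := exists_isTop (A ++ t :: B).idxOf ⟨j, hj⟩
    rcases (idxOf_le_iff hc).1 ((hik k hk).trans ((idxOf_le_iff hc).2 (hu k hk.1))) with hiA | rfl
    · refine absurd ?_ (hno (V.col i) fun a ha => (idxOf_lt_iff hc).1
        ((h.upper a i ha).trans_lt ((idxOf_lt_iff hc).2 hiA)))
      rwa [h.mulVec_col]
    · exact ⟨R, V, h, (low_eq_some_iff hr _ _).2 hi⟩

theorem exists_isPaired {cols : List n} (hr : IsOrder rows) (hc : IsOrder cols) {u : n → F} {σ : m}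
    (h : IsTop rows.idxOf (D *ᵥ u) σ) : ∃ τ, IsPaired rows cols D σ τ := by
  obtain ⟨R, V, hred⟩ := exists_isReduction hr hc D
  obtain ⟨τ, hτ, -⟩ := hred.exists_isTop_col hr hc h
  exact ⟨τ, R, V, hred, (low_eq_some_iff hr _ _).2 hτ⟩

/-- The pairing can be read off any reduced matrix. -/
theorem IsReduction.isTop_col_of_isPaired {cols : List n} {R : Matrix m n F} {V : Matrix n n F}
    (hr : IsOrder rows) (hc : IsOrder cols) (h : IsReduction rows cols D R V) {σ : m}
    (hσ : IsPaired rows cols D σ t) : IsTop rows.idxOf (R.col t) σ := by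
  obtain ⟨R', V', h', hlow⟩ := hσ
  rw [low_eq_some_iff hr] at hlow
  obtain ⟨i, hi, hit⟩ := h.exists_isTop_col hr hc (h'.mulVec_col t ▸ hlow)
  obtain ⟨j, hj, hji⟩ := h'.exists_isTop_col hr hc (h.mulVec_col i ▸ hi)
  obtain rfl := h'.isTop_unique hr _ _ _ hlow hj
  obtain rfl := hc.injective (le_antisymm (hit _ (h'.isTop_col hc _)) (hji _ (h.isTop_col hc _)))
  exact hi

/-- Whether a column is positive does not depend on the reduced matrix. -/
theorem IsReduction.col_eq_zero {cols : List n} {R R' : Matrix m n F} {V V' : Matrix n n F}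
    (hr : IsOrder rows) (hc : IsOrder cols) (h : IsReduction rows cols D R V)
    (h' : IsReduction rows cols D R' V') (hlow : low rows (R'.col t) = none) (s : m) :
    R s t = 0 := by
  by_contra hs
  obtain ⟨s', hs', -⟩ := h.exists_mulVec_ne_zero hr hc (h'.isTop_col hc t) hs
  rw [h'.mulVec_col] at hs'
  exact hs' ((low_eq_none_iff hr _).1 hlow s')

/-- `t` is positive and unpaired if it is the last simplex of a cycle, but not of a boundary. -/
theorem isUnpaired_append_iff [Fintype l] [DecidableEq l] {next : List l} {D' : Matrix n l F}
    (hr : IsOrder rows) (hc : IsOrder (A ++ t :: B)) (hn : IsOrder next) :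
    IsUnpaired rows (A ++ t :: B) next D D' t ↔
      (∃ u : n → F, u t ≠ 0 ∧ (∀ i, u i ≠ 0 → i ∈ A ∨ i = t) ∧ D *ᵥ u = 0) ∧
      ∀ w : l → F, ¬ ((D' *ᵥ w) t ≠ 0 ∧ ∀ i, (D' *ᵥ w) i ≠ 0 → i ∈ A ∨ i = t) := by
  simp only [← isTop_append_iff hc, ← and_assoc]
  refine and_congr ⟨?_, ?_⟩ ⟨fun hno w hw => ?_, ?_⟩
  · rintro ⟨R, V, h, hlow⟩
    refine ⟨V.col t, h.isTop_col hc t, ?_⟩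
    rw [h.mulVec_col]
    exact funext ((low_eq_none_iff hr _).1 hlow)
  · rintro ⟨u, hu, hDu⟩
    obtain ⟨R, V, h⟩ := exists_isReduction hr hc D
    refine ⟨R, V, h, (low_eq_none_iff hr _).2 fun s => ?_⟩
    by_contra hs
    obtain ⟨s', hs', -⟩ := h.exists_mulVec_ne_zero hr hc hu hs
    exact hs' (by rw [hDu]; rfl)
  · obtain ⟨ρ, hρ⟩ := exists_isPaired hc hn hw
    exact hno ρ hρ
  · rintro hno ρ ⟨R, V, h, hlow⟩
    refine hno (V.col ρ) ?_
    rw [h.mulVec_col]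
    exact (low_eq_some_iff hc _ _).1 hlow

end Pairing

/-! ### A single transposition -/

section Transposition

variable {l m n F : Type*} [Field F] [DecidableEq n] {cols A X post : List n} {t τ : n}
  {V : Matrix n n F}

/-- The situation before `t` is transposed past the block `X`: in the original order `cols`, the
simplices in `A` precede `t`, those in `X` (among them `τ`) come after `t`, and of the simplices
outside `A` and other than `t`, the block `X` contains exactly those in the support of the column
of `τ` in `V`. -/
structure IsBlock (cols : List n) (V : Matrix n n F) (A X : List n) (t τ : n) : Prop where
  lt : ∀ i ∈ A, cols.idxOf i < cols.idxOf t
  gt : ∀ i ∈ X, cols.idxOf t < cols.idxOf i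
  last_mem : τ ∈ X
  ne_zero : ∀ i ∈ X, V i τ ≠ 0
  cover : ∀ i, V i τ ≠ 0 → i ∈ A ++ X ∨ i = t

theorem IsBlock.lt_last (hb : IsBlock cols V A X t τ) : cols.idxOf t < cols.idxOf τ :=
  hb.gt τ hb.last_mem

theorem IsBlock.lt_of_mem (hb : IsBlock cols V A X t τ) {i : n} (hi : i ∈ A ∨ i = t) :
    cols.idxOf i < cols.idxOf τ := by
  rcases hi with hi | rfl
  · exact (hb.lt i hi).trans hb.lt_last
  · exact hb.lt_last

/-- The last position of a vector that is non-zero at `t`, vanishes at `τ` and lives on `A`, `t`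
and `X`. -/
theorem IsBlock.top_cases (hb : IsBlock cols V A X t τ) {u : n → F} {k : n}
    (hk : IsTop cols.idxOf u k) (ht : u t ≠ 0) (hτ : u τ = 0)
    (hu : ∀ i, u i ≠ 0 → i ∈ A ++ X ∨ i = t) : k = t ∨ V k τ ≠ 0 ∧ k ≠ τ := by
  rcases hu k hk.1 with h | h
  · rcases List.mem_append.1 h with h | h
    · exact absurd (hb.lt k h) (not_lt.2 (hk.2 t ht))
    · exact Or.inr ⟨hb.ne_zero k h, fun hkτ => hk.1 (hkτ ▸ hτ)⟩
  · exact Or.inl h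

variable [Fintype n] [Finite m] [DecidableEq m] {rows : List m} {D R : Matrix m n F}

/-- The property of the lazy reduction on which everything rests: if the last position `k` of `u` is
a column that was used to reduce `τ`, then `D u` has a non-zero entry below the reduced column of
`τ`. -/
theorem IsLazy.exists_mulVec_ne_zero (hr : IsOrder rows) (hc : IsOrder cols)
    (h : IsLazy rows cols D cols R V) {u : n → F} {k : n} (hk : IsTop cols.idxOf u k)
    (hV : V k τ ≠ 0) (hkτ : k ≠ τ) :
    ∃ s, (D *ᵥ u) s ≠ 0 ∧ ∀ s', R s' τ ≠ 0 → rows.idxOf s' < rows.idxOf s := by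
  obtain ⟨-, -, q, hq, hlt⟩ := h.lazy k τ hV hkτ
  obtain ⟨s, hs, hqs⟩ := (h.isReduction hr hc).exists_mulVec_ne_zero hr hc hk hq.1
  exact ⟨s, hs, fun s' hs' => (hlt s' hs').trans_le hqs⟩

/-- Transposing `t` past the block `X` makes it become paired with the partner `σ` of `τ` exactly if
`t` is in the support of the column of `τ` in `V`. -/
theorem isPaired_transposition_iff (hr : IsOrder rows) (hc : IsOrder cols)
    (h : IsLazy rows cols D cols R V) (hb : IsBlock cols V A X t τ)
    (ho : IsOrder (A ++ t :: (X ++ post))) (ho' : IsOrder (A ++ X ++ t :: post)) {σ : m}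
    (hσ : IsTop rows.idxOf (R.col τ) σ) :
    ¬ IsPaired rows (A ++ t :: (X ++ post)) D σ t ∧ IsPaired rows (A ++ X ++ t :: post) D σ t ↔
      V t τ ≠ 0 := by
  have hred := h.isReduction hr hc
  have hVτ : D *ᵥ V.col τ = R.col τ := hred.mulVec_col τ
  -- no combination of columns before `τ` has its low in row `σ`
  have hno : ∀ u : n → F, (∀ i, u i ≠ 0 → cols.idxOf i < cols.idxOf τ) →
      ¬ IsTop rows.idxOf (D *ᵥ u) σ := by
    intro u hu hσu
    obtain ⟨i, hi, hik⟩ := hred.exists_isTop_col hr hc hσu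
    obtain rfl := hred.isTop_unique hr _ _ _ hσ hi
    obtain ⟨j, -, hj⟩ := exists_ne_zero_of_mulVec hσu.1
    obtain ⟨k, hk⟩ := exists_isTop cols.idxOf ⟨j, hj⟩
    exact absurd (hu k hk.1) (not_lt.2 (hik k hk))
  rw [isPaired_append_iff hr ho, isPaired_append_iff hr ho']
  constructor
  · rintro ⟨-, -, hno'⟩ ht
    refine hno' (V.col τ) (fun i hi => (hb.cover i hi).resolve_right ?_) (hVτ ▸ hσ)
    rintro rfl
    exact hi ht
  · intro ht
    refine ⟨?_, ⟨V.col τ, hb.cover, hVτ ▸ hσ⟩, fun w hw hσw => ?_⟩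
    · rintro ⟨⟨u, hu, hσu⟩, -⟩
      exact hno u (fun i hi => hb.lt_of_mem (hu i hi)) hσu
    · have hwτ : w τ ≠ 0 := by
        intro hwτ
        refine hno w (fun i hi => ?_) hσw
        rcases List.mem_append.1 (hw i hi) with hiA | hiX
        · exact hb.lt_of_mem (Or.inl hiA)
        · exact (h.lazy i τ (hb.ne_zero i hiX) fun hiτ => hi (hiτ ▸ hwτ)).2.1
      have hwt : w t = 0 := by
        by_contra hwt
        have hn := ho'.nodup
        rw [List.nodup_append] at hn
        exact hn.2.2 t (hw t hwt) t (by simp) rfl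
      -- subtract a multiple of `w` from the column of `τ` in `V` to clear the entry at `τ`
      let u : n → F := V.col τ - (w τ)⁻¹ • w
      have hut : u t ≠ 0 := by simpa [u, hwt, Matrix.col_apply] using ht
      have huτ : u τ = 0 := by simp [u, hwτ, Matrix.col_apply, h.diag]
      have hu : ∀ i, u i ≠ 0 → i ∈ A ++ X ∨ i = t := by
        intro i hi
        by_cases hwi : w i = 0
        · exact hb.cover i (by simpa [u, hwi, Matrix.col_apply] using hi)
        · exact Or.inl (hw i hwi)
      obtain ⟨k, hk⟩ := exists_isTop cols.idxOf ⟨t, hut⟩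
      have hkV : V k τ ≠ 0 ∧ k ≠ τ := by
        rcases hb.top_cases hk hut huτ hu with rfl | hkV
        · exact ⟨ht, fun hkτ => hut (hkτ ▸ huτ)⟩
        · exact hkV
      obtain ⟨s, hs, hlt⟩ := h.exists_mulVec_ne_zero hr hc hk hkV.1 hkV.2
      have hDu : (D *ᵥ u) s = R s τ - (w τ)⁻¹ * (D *ᵥ w) s := by
        simp only [u, Matrix.mulVec_sub, Matrix.mulVec_smul, hVτ]
        rfl
      have hσs : rows.idxOf s ≤ rows.idxOf σ := by
        by_cases hws : (D *ᵥ w) s = 0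
        · exact hσ.2 s (by simpa [hDu, hws] using hs)
        · exact hσw.2 s hws
      exact absurd (hlt σ hσ.1) (not_lt.2 hσs)

/-- For `τ` positive and unpaired, transposing `t` past the block `X` makes it become positive and
unpaired exactly if `t` is in the support of the column of `τ` in `V`. -/
theorem isUnpaired_transposition_iff [Fintype l] [DecidableEq l] {next : List l}
    {D' : Matrix n l F} (hr : IsOrder rows) (hc : IsOrder cols) (hn : IsOrder next)
    (hDD : D * D' = 0) (h : IsLazy rows cols D cols R V) (hb : IsBlock cols V A X t τ)
    (ho : IsOrder (A ++ t :: (X ++ post))) (ho' : IsOrder (A ++ X ++ t :: post))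
    (hR : ∀ s, R s τ = 0) (hτ : ∀ w : l → F, ¬ IsTop cols.idxOf (D' *ᵥ w) τ) :
    ¬ IsUnpaired rows (A ++ t :: (X ++ post)) next D D' t ∧
      IsUnpaired rows (A ++ X ++ t :: post) next D D' t ↔ V t τ ≠ 0 := by
  have hVτ : D *ᵥ V.col τ = 0 := ((h.isReduction hr hc).mulVec_col τ).trans (funext hR)
  have htτ : t ≠ τ := fun he => (he ▸ hb.lt_last).false
  -- the last position of a cycle is not a column used to reduce `τ`
  have hcyc : ∀ u : n → F, D *ᵥ u = 0 → u t ≠ 0 → u τ = 0 →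
      (∀ i, u i ≠ 0 → i ∈ A ++ X ∨ i = t) → IsTop cols.idxOf u t ∧ V t τ = 0 := by
    intro u hDu hut huτ hu
    obtain ⟨k, hk⟩ := exists_isTop cols.idxOf ⟨t, hut⟩
    have hkV : ¬ (V k τ ≠ 0 ∧ k ≠ τ) := by
      rintro ⟨hkV, hkτ⟩
      obtain ⟨s, hs, -⟩ := h.exists_mulVec_ne_zero hr hc hk hkV hkτ
      exact hs (by rw [hDu]; rfl)
    obtain rfl := (hb.top_cases hk hut huτ hu).resolve_right hkV
    exact ⟨hk, by_contra fun hV => hkV ⟨hV, htτ⟩⟩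
  rw [isUnpaired_append_iff hr ho hn, isUnpaired_append_iff hr ho' hn]
  constructor
  · rintro ⟨hno, ⟨z, hzt, hz, hDz⟩, hbd⟩ ht
    -- clear the entry of the cycle `z` at `τ`: the result lives on `A` and `t`
    let u : n → F := z - z τ • V.col τ
    have hut : u t ≠ 0 := by simpa [u, ht, Matrix.col_apply] using hzt
    have hDu : D *ᵥ u = 0 := by
      simp [u, Matrix.mulVec_sub, Matrix.mulVec_smul, hVτ, hDz]
    have hu : ∀ i, u i ≠ 0 → i ∈ A ++ X ∨ i = t := by
      intro i hi
      by_cases hzi : z i = 0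
      · refine hb.cover i fun hVi => hi ?_
        simp [u, hzi, Matrix.col_apply, hVi]
      · exact hz i hzi
    obtain ⟨htop, -⟩ := hcyc u hDu hut (by simp [u, Matrix.col_apply, h.diag]) hu
    refine hno ⟨⟨u, hut, fun i hi => ?_, hDu⟩, fun w hw => hbd w ⟨hw.1, fun i hi => ?_⟩⟩
    · rcases hu i hi with hi' | hi'
      · rcases List.mem_append.1 hi' with hiA | hiX
        · exact Or.inl hiA
        · exact absurd (hb.gt i hiX) (not_lt.2 (htop.2 i hi))
      · exact Or.inr hi'
    · exact (hw.2 i hi).imp_left (List.mem_append_left _)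
  · intro ht
    refine ⟨?_, ⟨V.col τ, ht, hb.cover, hVτ⟩, fun w hw => ?_⟩
    · rintro ⟨⟨u, hut, hu, hDu⟩, -⟩
      refine ht (hcyc u hDu hut ?_ fun i hi => (hu i hi).imp_left (List.mem_append_left _)).2
      by_contra huτ
      exact (hb.lt_of_mem (hu τ huτ)).false
    · have hDw : D *ᵥ (D' *ᵥ w) = 0 := by
        rw [Matrix.mulVec_mulVec, hDD, Matrix.zero_mulVec]
      refine ht (hcyc _ hDw hw.1 ?_ hw.2).2
      by_contra hwτ
      refine hτ w ⟨hwτ, fun i hi => ?_⟩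
      rcases hw.2 i hi with hi' | rfl
      · rcases List.mem_append.1 hi' with hiA | hiX
        · exact (hb.lt_of_mem (Or.inl hiA)).le
        · exact (h.isReduction hr hc).upper i τ (hb.ne_zero i hiX)
      · exact hb.lt_last.le

end Transposition

/-! ### The accumulated set -/

section Accumulate

variable {n : Type*}

open Classical in
/-- If every transposition adds `t` to the block exactly when `P t` holds, then the simplices
satisfying `P` are accumulated. In `hstep`, the simplices in `B` have been treated already. -/
theorem accumulate_eq {Q : List n → n → Prop} {P : n → Prop} {cols pre after : List n} {τ : n}
    (hstep : ∀ A t B post, cols = A ++ t :: B ++ τ :: after →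
      (A ++ t :: ((B.filter fun i => decide (P i)) ++ [τ] ++ post)).Perm cols →
      (¬ Q (A ++ t :: ((B.filter fun i => decide (P i)) ++ [τ] ++ post)) t ∧
        Q (A ++ ((B.filter fun i => decide (P i)) ++ [τ]) ++ t :: post) t ↔ P t))
    (todo B post : List n) (hcols : cols = pre ++ todo.reverse ++ B ++ τ :: after)
    (hperm : (pre ++ todo.reverse ++ ((B.filter fun i => decide (P i)) ++ [τ]) ++ post).Perm
      cols) :
    accumulate Q pre todo ((B.filter fun i => decide (P i)) ++ [τ]) post =
      (todo.reverse ++ B).filter (fun i => decide (P i)) ++ [τ] := by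
  induction todo generalizing B post with
  | nil => simp [accumulate]
  | cons t todo ih =>
    have hcols' : cols = pre ++ todo.reverse ++ (t :: B) ++ τ :: after := by
      rw [hcols]; simp
    have hs := hstep (pre ++ todo.reverse) t B post hcols' (by simpa using hperm)
    have h1 : pre ++ todo.reverse ++ [t] ++ ((B.filter fun i => decide (P i)) ++ [τ]) ++ post =
        pre ++ todo.reverse ++ t :: ((B.filter fun i => decide (P i)) ++ [τ] ++ post) := by simp
    have h2 : pre ++ todo.reverse ++ ((B.filter fun i => decide (P i)) ++ [τ]) ++ [t] ++ post =
        pre ++ todo.reverse ++ ((B.filter fun i => decide (P i)) ++ [τ]) ++ t :: post := by simp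
    rw [accumulate, h1, h2]
    by_cases hP : P t
    · rw [if_pos (hs.2 hP)]
      have := ih (t :: B) post hcols' (by simpa [hP] using hperm)
      simpa [hP] using this
    · rw [if_neg (fun h => hP (hs.1 h))]
      have := ih (t :: B) (t :: post) hcols' ?_
      · simpa [hP] using this
      · refine List.Perm.trans ?_ hperm
        simp only [List.filter_cons, hP, decide_false, List.reverse_cons, List.append_assoc]
        refine List.Perm.append_left _ (List.Perm.append_left _ ?_)
        simpa using (List.perm_middle (a := t)
          (l₁ := (B.filter fun i => decide (P i)) ++ [τ]) (l₂ := post))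

/-- In a list sorted by `g`, the elements with values below `d` come first. -/
theorem filter_lt_append_filter_le (g : n → ℝ) (d : ℝ) {l : List n}
    (h : l.Pairwise fun s t => g s ≤ g t) :
    (l.filter fun t => decide (g t < d)) ++ (l.filter fun t => decide (d ≤ g t)) = l := by
  induction l with
  | nil => rfl
  | cons a l ih =>
    rw [List.pairwise_cons] at h
    by_cases ha : g a < d
    · simpa [ha, not_le.2 ha] using ih h.2
    · have h1 : (l.filter fun t => decide (g t < d)) = [] := by
        simpa using fun t ht => (not_lt.1 ha).trans (h.1 t ht)
      have h2 : (l.filter fun t => decide (d ≤ g t)) = l := by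
        simpa using fun t ht => (not_lt.1 ha).trans (h.1 t ht)
      simp [ha, not_lt.1 ha, h1, h2]

open Classical in
theorem accumulatedSet_append (Q : List n → n → Prop) (g : n → ℝ) (d' : ℝ) {before after : List n}
    {τ : n} (h : ∀ t ∈ before, t ≠ τ) :
    accumulatedSet Q (before ++ τ :: after) g d' τ =
      {t | t ∈ accumulate Q (before.filter fun t => decide (g t < d'))
        (before.filter fun t => decide (d' ≤ g t)).reverse [τ] after} := by
  have htake : (before ++ τ :: after).takeWhile (fun t => decide (t ≠ τ)) = before := by
    rw [List.takeWhile_append_of_pos (by simpa using h)]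
    simp
  have hdrop : ((before ++ τ :: after).dropWhile fun t => decide (t ≠ τ)).tail = after := by
    rw [List.dropWhile_append_of_pos (by simpa using h)]
    simp
  rw [accumulatedSet, htake, hdrop]

variable [Fintype n] [DecidableEq n] {m F : Type*} [Field F] [DecidableEq m] {rows : List m}
  {cols : List n} {D R : Matrix m n F} {V : Matrix n n F}

/-- If every transposition adds `t` to the block exactly when `V t τ ≠ 0`, then the accumulated set
is the part of the support of the column of `τ` in `V` with values at least `d'`. -/
theorem IsLazy.accumulatedSet_eq (hc : IsOrder cols) (h : IsLazy rows cols D cols R V)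
    {Q : List n → n → Prop} {g : n → ℝ} (hg : cols.Pairwise fun s t => g s ≤ g t) {d' : ℝ} {τ : n}
    (hd : d' ≤ g τ)
    (hstep : ∀ A X post t, IsBlock cols V A X t τ → IsOrder (A ++ t :: (X ++ post)) →
      IsOrder (A ++ X ++ t :: post) →
      (¬ Q (A ++ t :: (X ++ post)) t ∧ Q (A ++ X ++ t :: post) t ↔ V t τ ≠ 0)) :
    accumulatedSet Q cols g d' τ = {t | d' ≤ g t ∧ g t ≤ g τ ∧ V t τ ≠ 0} := by
  classical
  obtain ⟨before, after, hcols, hbefore⟩ :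
      ∃ before after, cols = before ++ τ :: after ∧ ∀ t ∈ before, t ≠ τ := by
    obtain ⟨before, after, hcols⟩ := List.append_of_mem (hc.complete τ)
    refine ⟨before, after, hcols, fun t ht he => ?_⟩
    have hn := hc.nodup
    rw [hcols, List.nodup_append] at hn
    exact hn.2.2 t ht τ (by simp) he
  have hgb : before.Pairwise (fun s t => g s ≤ g t) ∧ ∀ t ∈ before, g t ≤ g τ := by
    rw [hcols, List.pairwise_append] at hg
    exact ⟨hg.1, fun t ht => hg.2.2 t ht τ (by simp)⟩
  have hsplit := filter_lt_append_filter_le g d' hgb.1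
  have hsupp : ∀ i, V i τ ≠ 0 → i ∈ before ∨ i = τ := by
    intro i hi
    by_cases hiτ : i = τ
    · exact Or.inr hiτ
    · have := (h.lazy i τ hi hiτ).2.1
      subst hcols
      exact Or.inl ((idxOf_lt_iff hc).1 this)
  have key := accumulate_eq (Q := Q) (P := fun t => V t τ ≠ 0) (cols := cols)
    (pre := before.filter fun t => decide (g t < d')) (after := after) (τ := τ) ?_
    (before.filter fun t => decide (d' ≤ g t)).reverse [] after
    (by rw [List.reverse_reverse, hsplit]; simpa using hcols)
    (by rw [List.reverse_reverse, hsplit]; simp [hcols])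
  · ext t
    rw [hcols, accumulatedSet_append Q g d' hbefore]
    simp only [List.filter_nil, List.nil_append, List.reverse_reverse, List.append_nil] at key
    simp only [Set.mem_ofPred_eq, key, List.mem_append, List.mem_filter, List.mem_singleton,
      decide_eq_true_eq]
    constructor
    · rintro (⟨⟨h1, h2⟩, h3⟩ | rfl)
      · exact ⟨h2, hgb.2 t h1, h3⟩
      · exact ⟨hd, le_rfl, by simp [h.diag]⟩
    · rintro ⟨h1, -, h3⟩
      exact (hsupp t h3).imp_left fun h4 => ⟨⟨h4, h1⟩, h3⟩
  · intro A t B post hAB hperm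
    have ho := hc.perm hperm
    refine hstep A _ post t ?_ ho (hc.perm (List.Perm.trans ?_ hperm))
    · have hbef : before = A ++ t :: B :=
        List.append_inj_left' (by rw [← hcols, hAB]) rfl
      have hAB' : cols = A ++ t :: (B ++ τ :: after) := by simp [hAB]
      have hgt : ∀ i ∈ B ++ τ :: after, cols.idxOf t < cols.idxOf i := by
        intro i hi
        have hn := hc.nodup
        rw [hAB', List.nodup_append] at hn
        rw [hAB'] at hc ⊢
        refine not_le.1 fun hle => ?_
        rcases (idxOf_le_iff hc).1 hle with hiA | rfl
        · exact hn.2.2 i hiA i (List.mem_cons_of_mem _ hi) rfl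
        · exact (List.nodup_cons.1 hn.2.1).1 hi
      refine ⟨fun i hi => ?_, fun i hi => hgt i ?_, by simp, fun i hi => ?_, fun i hi => ?_⟩
      · rw [hAB'] at hc ⊢
        exact (idxOf_lt_iff hc).2 hi
      · simp only [List.mem_append, List.mem_filter, List.mem_singleton] at hi
        rcases hi with hi | rfl
        · exact List.mem_append_left _ hi.1
        · simp
      · simp only [List.mem_append, List.mem_filter, List.mem_singleton, decide_eq_true_eq] at hi
        rcases hi with hi | rfl
        · exact hi.2
        · simp [h.diag]
      · have := hsupp i hi
        rw [hbef] at this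
        simp only [List.mem_append, List.mem_cons, List.mem_filter, decide_eq_true_eq] at this ⊢
        tauto
    · rw [List.append_assoc]
      exact List.Perm.append_left _ List.perm_middle

variable [Finite m] {τ : n} {d' : ℝ} {g : n → ℝ}

theorem IsLazy.accumulatedSet_isPaired (hr : IsOrder rows) (hc : IsOrder cols)
    (h : IsLazy rows cols D cols R V) (hg : cols.Pairwise fun s t => g s ≤ g t) (hd : d' ≤ g τ)
    {σ : m} (hσ : IsPaired rows cols D σ τ) :
    accumulatedSet (fun order t => IsPaired rows order D σ t) cols g d' τ =
      {t | d' ≤ g t ∧ g t ≤ g τ ∧ V t τ ≠ 0} :=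
  h.accumulatedSet_eq hc hg hd fun _ _ _ _ hb ho ho' =>
    isPaired_transposition_iff hr hc h hb ho ho'
      ((h.isReduction hr hc).isTop_col_of_isPaired hr hc hσ)

theorem IsLazy.accumulatedSet_isUnpaired {l : Type*} [Fintype l] [DecidableEq l] {next : List l}
    {D' : Matrix n l F} (hr : IsOrder rows) (hc : IsOrder cols) (hn : IsOrder next)
    (hDD : D * D' = 0) (h : IsLazy rows cols D cols R V)
    (hg : cols.Pairwise fun s t => g s ≤ g t) (hd : d' ≤ g τ)
    (hτ : IsUnpaired rows cols next D D' τ) :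
    accumulatedSet (fun order t => IsUnpaired rows order next D D' t) cols g d' τ =
      {t | d' ≤ g t ∧ g t ≤ g τ ∧ V t τ ≠ 0} := by
  obtain ⟨⟨R', V', h', hlow⟩, hunp⟩ := hτ
  refine h.accumulatedSet_eq hc hg hd fun _ _ _ _ hb ho ho' =>
    isUnpaired_transposition_iff hr hc hn hDD h hb ho ho'
      ((h.isReduction hr hc).col_eq_zero hr hc h' hlow) fun w hw => ?_
  obtain ⟨ρ, hρ⟩ := exists_isPaired hc hn hw
  exact hunp ρ hρ

end Accumulate

/-! ### Filtration orders and boundary matrices -/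

section Simplices

variable {W : Type*} {K : PreAbstractSimplicialComplex W}

theorem IsFiltrationOrder.isOrder_simplicesOf {f : K → ℝ} {L : List K}
    (hL : IsFiltrationOrder K f L) (n : ℕ) : IsOrder (simplicesOf L n) where
  nodup := by
    refine hL.nodup.filterMap fun a a' b hb hb' => ?_
    simp only [Option.mem_def, Option.dite_none_right_eq_some, Option.some.injEq] at hb hb'
    obtain ⟨_, rfl⟩ := hb
    obtain ⟨_, hb'⟩ := hb'
    exact (congrArg Subtype.val hb').symm
  complete s := by
    rw [simplicesOf, List.mem_filterMap]
    exact ⟨s.1, hL.complete _, by simp [s.2]⟩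

theorem IsFiltrationOrder.pairwise_simplicesOf {f : K → ℝ} {L : List K}
    (hL : IsFiltrationOrder K f L) (n : ℕ) :
    (simplicesOf L n).Pairwise fun s t => f s.1 ≤ f t.1 := by
  refine List.Pairwise.filterMap _ (fun a a' haa b hb b' hb' => ?_) hL.sorted
  simp only [Option.dite_none_right_eq_some, Option.some.injEq] at hb hb'
  obtain ⟨_, rfl⟩ := hb
  obtain ⟨_, rfl⟩ := hb'
  exact haa.1

variable [LinearOrder W]

theorem card_filter_lt_erase (ρ : Finset W) {v w : W} (hv : v ∈ ρ) (h : v < w) :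
    (ρ.filter (· < w)).card = ((ρ.erase v).filter (· < w)).card + 1 ∧
      ((ρ.erase w).filter (· < v)).card = (ρ.filter (· < v)).card := by
  rw [Finset.filter_erase, Finset.filter_erase, Finset.card_erase_add_one (by simp [hv, h]),
    Finset.erase_eq_of_notMem (by simp [h.le])]
  exact ⟨rfl, rfl⟩

/-- Deleting two vertices in either order gives the same face with opposite signs. -/
theorem sign_add_sign (F : Type*) [Field F] (ρ : Finset W) {v w : W} (hv : v ∈ ρ) (hw : w ∈ ρ)
    (h : v ≠ w) :
    (-1 : F) ^ ((ρ.erase w).filter (· < v)).card * (-1) ^ (ρ.filter (· < w)).card +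
      (-1) ^ ((ρ.erase v).filter (· < w)).card * (-1) ^ (ρ.filter (· < v)).card = 0 := by
  rcases lt_or_gt_of_ne h with h | h
  · obtain ⟨h1, h2⟩ := card_filter_lt_erase ρ hv h
    rw [h1, h2]; ring
  · obtain ⟨h1, h2⟩ := card_filter_lt_erase ρ hw h
    rw [h1, h2]; ring

theorem bdry_mul_bdry (F : Type*) [Field F] (K : PreAbstractSimplicialComplex W) (p : ℕ)
    [Fintype (Simp K (p + 1))] : bdry F K p * bdry F K (p + 1) = 0 := by
  ext σ ρ
  let G : (Σ _ : W, W) → F := fun x =>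
    if σ.1.1 = (ρ.1.1.erase x.1).erase x.2 then
      (-1 : F) ^ ((ρ.1.1.erase x.1).filter (· < x.2)).card *
        (-1) ^ (ρ.1.1.filter (· < x.1)).card
    else 0
  have h1 : (bdry F K p * bdry F K (p + 1)) σ ρ =
      ∑ x ∈ ρ.1.1.sigma fun w => ρ.1.1.erase w, G x := by
    rw [Matrix.mul_apply, Finset.sum_sigma]
    simp only [bdry, Finset.mul_sum]
    rw [Finset.sum_comm]
    refine Finset.sum_congr rfl fun w hw => ?_
    have hcard : (ρ.1.1.erase w).card = p + 1 := by
      rw [Finset.card_erase_of_mem hw, ρ.2]; rfl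
    have hmem : ρ.1.1.erase w ∈ K :=
      (K.isRelLowerSet_faces ρ.1.2).2 (Finset.erase_subset _ _)
        (Finset.card_pos.1 (by omega))
    rw [Finset.sum_eq_single (⟨⟨ρ.1.1.erase w, hmem⟩, hcard⟩ : Simp K (p + 1))]
    · simp only [if_true, Finset.sum_mul, G, ite_mul, zero_mul]
    · intro τ _ hτ
      rw [if_neg, mul_zero]
      exact fun he => hτ (Subtype.ext (Subtype.ext he))
    · simp
  rw [h1, Matrix.zero_apply]
  refine Finset.sum_involution (fun x _ => ⟨x.2, x.1⟩) (fun x hx => ?_) (fun x hx _ he => ?_)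
    (fun x hx => ?_) (fun x _ => rfl)
  · simp only [Finset.mem_sigma, Finset.mem_erase] at hx
    simp only [G, Finset.erase_right_comm (a := x.2) (b := x.1)]
    split_ifs
    · exact sign_add_sign F ρ.1.1 hx.2.2 hx.1 hx.2.1
    · simp
  · simp only [Finset.mem_sigma, Finset.mem_erase] at hx
    exact hx.2.1 (congrArg Sigma.fst he)
  · simp only [Finset.mem_sigma, Finset.mem_erase] at hx ⊢
    exact ⟨hx.2.2, hx.2.1.symm, hx.1⟩

end Simplices

end LazyPersistence

theorem mainTheorem2 {W : Type*} [LinearOrder W] (F : Type*) [Field F]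
    (K : PreAbstractSimplicialComplex W) [Fintype K]
    (f : K → ℝ) (hf : ∀ s t : K, s.1 ⊆ t.1 → f s ≤ f t)
    (L : List K) (hL : LazyPersistence.IsFiltrationOrder K f L)
    (p : ℕ) (τ : LazyPersistence.Simp K (p + 1)) (d' : ℝ) (hd : d' ≤ f τ.1)
    (R : Matrix (LazyPersistence.Simp K p) (LazyPersistence.Simp K (p + 1)) F)
    (V : Matrix (LazyPersistence.Simp K (p + 1)) (LazyPersistence.Simp K (p + 1)) F)
    (hRV : LazyPersistence.lazyReduction (LazyPersistence.simplicesOf L p)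
      (LazyPersistence.simplicesOf L (p + 1)) (LazyPersistence.bdry F K p) = (R, V)) :
    (∀ σ : LazyPersistence.Simp K p,
      LazyPersistence.IsPaired (LazyPersistence.simplicesOf L p)
        (LazyPersistence.simplicesOf L (p + 1)) (LazyPersistence.bdry F K p) σ τ →
      LazyPersistence.accumulatedSet
        (fun order t => LazyPersistence.IsPaired (LazyPersistence.simplicesOf L p) order
          (LazyPersistence.bdry F K p) σ t)
        (LazyPersistence.simplicesOf L (p + 1)) (fun t => f t.1) d' τ =
      {t | d' ≤ f t.1 ∧ f t.1 ≤ f τ.1 ∧ V t τ ≠ 0}) ∧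
    (LazyPersistence.IsUnpaired (LazyPersistence.simplicesOf L p)
        (LazyPersistence.simplicesOf L (p + 1)) (LazyPersistence.simplicesOf L (p + 2))
        (LazyPersistence.bdry F K p) (LazyPersistence.bdry F K (p + 1)) τ →
      LazyPersistence.accumulatedSet
        (fun order t => LazyPersistence.IsUnpaired (LazyPersistence.simplicesOf L p) order
          (LazyPersistence.simplicesOf L (p + 2))
          (LazyPersistence.bdry F K p) (LazyPersistence.bdry F K (p + 1)) t)
        (LazyPersistence.simplicesOf L (p + 1)) (fun t => f t.1) d' τ =
      {t | d' ≤ f t.1 ∧ f t.1 ≤ f τ.1 ∧ V t τ ≠ 0}) := by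
  classical
  have hr := hL.isOrder_simplicesOf p
  have hc := hL.isOrder_simplicesOf (p + 1)
  have hn := hL.isOrder_simplicesOf (p + 2)
  have hg := hL.pairwise_simplicesOf (p + 1)
  have h := LazyPersistence.isLazy_lazyReduction hr hc (LazyPersistence.bdry F K p)
  rw [hRV] at h
  exact ⟨fun σ hσ => h.accumulatedSet_isPaired hr hc hg hd hσ,
    fun hτ => h.accumulatedSet_isUnpaired hr hc hn (LazyPersistence.bdry_mul_bdry F K p) hg hd hτ⟩
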